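/- Consider a chain of $N\ge 1$ linear hyperbolic subsystems. For $i\in\{1,\dots,N\}$, $t>0$, $x\in[0,1]$, the states $u_i(t,x)\in\mathbb{R}^{n_i}$ and $v_i(t,x)\in\mathbb{R}^{m_i}$ ($n_i,m_i\ge1$) satisfy $$\partial_t u_i+\Lambda_i^+\partial_x u_i=\Sigma_i^{++}(x)u_i+\Sigma_i^{+-}(x)v_i,\qquad \partial_t v_i-\Lambda_i^-\partial_x v_i=\Sigma_i^{-+}(x)u_i+\Sigma_i^{--}(x)v_i,$$ $$u_i(t,0)=Q_{i,i}v_i(t,0)+Q_{i,i-1}u_{i-1}(t,1),\qquad v_i(t,1)=R_{i,i}u_i(t,1)+R_{i,i+1}v_{i+1}(t,0),$$ where $\Lambda_i^+=\mathrm{diag}(\lambda_i^1,\dots,\lambda_i^{n_i})$ with $0<\lambda_i^1<\dots<\lambda_i^{n_i}$, $\Lambda_i^-=\mathrm{diag}(\mu_i^1,\dots,\mu_i^{m_i})$ with $0<\mu_i^1<\dots<\mu_i^{m_i}$, the matrix functions $\Sigma_i^{\cdot\cdot}$ are continuous on $[0,1]$, and the matrices $Q_{i,j},R_{i,j}$ are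 constant. By convention $R_{N,N+1}=0$, $Q_{1,0}=\mathrm{Id}$, and $u_0(t,1)=U(t)\in\mathbb{R}^{n_1}$ is the control input. The boundary conditions hold for all $t\ge0$. A solution is understood in the class $C^0([0,\infty);H^1([0,1]))\cap C^1((0,\infty);L^2([0,1]))$, the differential equations holding in $L^2([0,1])$ for every $t>0$. The measured output is $y(t)=u_N(t,1)$. Assume that $\operatorname{rank}Q_{i,i-1}=n_{i-1}$ for all $i\in\{2,\dots,N\}$. Let $\tau>\sum_{j=1}^N 1/\lambda_j^1$ be a fixed delay, and write $\bar u_i(t,x)=u_i(t-\tau,x)$ and $\bar v_i(t,x)=v_i(t-\tau,x)$. Then there are state estimators $\hat u=(\hat u_i)_{1\le i\le N}$ and $\hat v=(\hat v_i)_{1\le i\le N}$, i.e. maps sending an output signal $y$ to functions $\hat u_i(t,x)\in\mathbb{R}^{n_i}$ and $\hat v_i(t,x)\in\mathbb{R}^{m_i}$, which depend only on the coefficients of the system and on $\tau$, and which are causal (their values at time $t$ depend only on the restriction of $y$ to $[0,t]$), such that for every control input $U$ and every solution $(u_i,v_i)_{1\le i\le N}$ of the system, with output $y$, the estimators applied to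 $y$ satisfy $$\hat u_i(t,x)=\bar u_i(t,x)\quad\text{and}\quad\hat v_i(t,x)=\bar v_i(t,x)$$ for all $i\in\{1,\dots,N\}$, all $x\in[0,1]$ and all $t\ge\tau+\sum_{j=i}^N 1/\mu_j^1$. -/

import Mathlib

open Set Filter Topology MeasureTheory
open scoped Matrix

noncomputable section

/-- Data of a chain of `N ≥ 1` linear hyperbolic subsystems.  Subsystem `i` has `n i` components
travelling to the right with speeds `lam i 0 < lam i 1 < ⋯` and `m i` components travelling to the
left with speeds `mu i 0 < mu i 1 < ⋯`.  Subsystems are numbered `0, …, N - 1`.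
Of the matrices `Q i j` only those with `j = i - 1` are used, of the matrices `R i j` only those
with `j = i + 1`. -/
structure HyperbolicChain where
  N : ℕ
  N_pos : 0 < N
  n : Fin N → ℕ
  m : Fin N → ℕ
  n_pos : ∀ i, 0 < n i
  m_pos : ∀ i, 0 < m i
  /-- rightward transport velocities -/
  lam : ∀ i, Fin (n i) → ℝ
  lam_pos : ∀ i k, 0 < lam i k
  lam_strictMono : ∀ i, StrictMono (lam i)
  /-- leftward transport velocities -/
  mu : ∀ i, Fin (m i) → ℝ
  mu_pos : ∀ i k, 0 < mu i k
  mu_strictMono : ∀ i, StrictMono (mu i)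
  /-- in-domain couplings, continuous on `[0,1]` -/
  Spp : ∀ i, ℝ → Matrix (Fin (n i)) (Fin (n i)) ℝ
  Spm : ∀ i, ℝ → Matrix (Fin (n i)) (Fin (m i)) ℝ
  Smp : ∀ i, ℝ → Matrix (Fin (m i)) (Fin (n i)) ℝ
  Smm : ∀ i, ℝ → Matrix (Fin (m i)) (Fin (m i)) ℝ
  Spp_cont : ∀ i, ContinuousOn (Spp i) (Icc 0 1)
  Spm_cont : ∀ i, ContinuousOn (Spm i) (Icc 0 1)
  Smp_cont : ∀ i, ContinuousOn (Smp i) (Icc 0 1)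
  Smm_cont : ∀ i, ContinuousOn (Smm i) (Icc 0 1)
  /-- coupling of the left ends: `Qd i` is `Q_{i,i}`, `Q i j` is `Q_{i,j}` for `j = i - 1` -/
  Qd : ∀ i, Matrix (Fin (n i)) (Fin (m i)) ℝ
  Q : ∀ i j, Matrix (Fin (n i)) (Fin (n j)) ℝ
  /-- coupling of the right ends: `Rd i` is `R_{i,i}`, `R i j` is `R_{i,j}` for `j = i + 1` -/
  Rd : ∀ i, Matrix (Fin (m i)) (Fin (n i)) ℝ
  R : ∀ i j, Matrix (Fin (m i)) (Fin (m j)) ℝ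

/-- `g t` is the (weak) derivative of `f t ∈ H¹([0,1])` for every `t ≥ 0`, and
`t ↦ f t` is continuous from `[0,∞)` to `H¹([0,1])`.  `H¹([0,1])` is the space of
absolutely continuous functions with square integrable derivative. -/
structure IsContinuousInH1 (f g : ℝ → ℝ → ℝ) : Prop where
  memLp : ∀ t, 0 ≤ t → MemLp (g t) 2 (volume.restrict (Icc (0 : ℝ) 1))
  eq_integral : ∀ t, 0 ≤ t → ∀ x ∈ Icc (0 : ℝ) 1, f t x = f t 0 + ∫ ξ in (0 : ℝ)..x, g t ξ
  continuous : ∀ t, 0 ≤ t →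
    Tendsto (fun s => eLpNorm (fun x => f s x - f t x) 2 (volume.restrict (Icc (0 : ℝ) 1)))
      (𝓝[Ici 0] t) (𝓝 0)
  continuous_deriv : ∀ t, 0 ≤ t →
    Tendsto (fun s => eLpNorm (fun x => g s x - g t x) 2 (volume.restrict (Icc (0 : ℝ) 1)))
      (𝓝[Ici 0] t) (𝓝 0)

/-- For every `t > 0`, `h t` is the derivative at `t` of `t ↦ f t`, as a map into `L²([0,1])`. -/
def HasTimeDerivInL2 (f h : ℝ → ℝ → ℝ) : Prop :=
  ∀ t, 0 < t →
    Tendsto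
      (fun s => eLpNorm (fun x => (s - t)⁻¹ * (f s x - f t x) - h t x) 2
        (volume.restrict (Icc (0 : ℝ) 1)))
      (𝓝[≠] t) (𝓝 0)

namespace HyperbolicChain

variable (S : HyperbolicChain)

/-- The first subsystem, on which the control acts. -/
def first : Fin S.N := ⟨0, S.N_pos⟩

/-- The last subsystem, at which the measurement is taken. -/
def last : Fin S.N := ⟨S.N - 1, Nat.sub_lt S.N_pos Nat.one_pos⟩

/-- The smallest rightward velocity of subsystem `i`. -/
def lamMin (i : Fin S.N) : ℝ := S.lam i ⟨0, S.n_pos i⟩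

/-- The smallest leftward velocity of subsystem `i`. -/
def muMin (i : Fin S.N) : ℝ := S.mu i ⟨0, S.m_pos i⟩

/-- Families of rightward states: `u i t x` is the vector `u_i(t,x)`. -/
abbrev RightState : Type := ∀ i : Fin S.N, ℝ → ℝ → Fin (S.n i) → ℝ

/-- Families of leftward states: `v i t x` is the vector `v_i(t,x)`. -/
abbrev LeftState : Type := ∀ i : Fin S.N, ℝ → ℝ → Fin (S.m i) → ℝ

/-- Output signals. -/
abbrev Signal : Type := ℝ → Fin (S.n S.last) → ℝ

/-- `(u, v)` is a solution of the interconnected system with control input `U`, in the class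
`C⁰([0,∞); H¹) ∩ C¹((0,∞); L²)`.  The initial state is `(u · 0, v · 0)`; it is in `H¹`, and the
boundary conditions at `t = 0` are its compatibility conditions. -/
structure IsSolution (U : ℝ → Fin (S.n S.first) → ℝ) (u : S.RightState) (v : S.LeftState) :
    Prop where
  /-- `∂ₜ u_i + Λ_i⁺ ∂ₓ u_i = Σ_i⁺⁺ u_i + Σ_i⁺⁻ v_i` -/
  pde_u : ∀ (i : Fin S.N) (k : Fin (S.n i)), ∃ ux : ℝ → ℝ → ℝ,
    IsContinuousInH1 (fun t x => u i t x k) ux ∧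
    HasTimeDerivInL2 (fun t x => u i t x k)
      (fun t x => -(S.lam i k) * ux t x
        + (S.Spp i x *ᵥ u i t x + S.Spm i x *ᵥ v i t x) k)
  /-- `∂ₜ v_i - Λ_i⁻ ∂ₓ v_i = Σ_i⁻⁺ u_i + Σ_i⁻⁻ v_i` -/
  pde_v : ∀ (i : Fin S.N) (k : Fin (S.m i)), ∃ vx : ℝ → ℝ → ℝ,
    IsContinuousInH1 (fun t x => v i t x k) vx ∧
    HasTimeDerivInL2 (fun t x => v i t x k)
      (fun t x => S.mu i k * vx t x
        + (S.Smp i x *ᵥ u i t x + S.Smm i x *ᵥ v i t x) k)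
  /-- the control enters the first subsystem -/
  bc_u_first : ∀ t, 0 ≤ t →
    u S.first t 0 = S.Qd S.first *ᵥ v S.first t 0 + U t
  bc_u : ∀ i j : Fin S.N, i.val = j.val + 1 → ∀ t, 0 ≤ t →
    u i t 0 = S.Qd i *ᵥ v i t 0 + S.Q i j *ᵥ u j t 1
  bc_v : ∀ i j : Fin S.N, j.val = i.val + 1 → ∀ t, 0 ≤ t →
    v i t 1 = S.Rd i *ᵥ u i t 1 + S.R i j *ᵥ v j t 0
  bc_v_last : ∀ t, 0 ≤ t →
    v S.last t 1 = S.Rd S.last *ᵥ u S.last t 1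

/-- The measurement `y(t) = u_N(t,1)`. -/
def output (u : S.RightState) : S.Signal := fun t => u S.last t 1

/-- The estimator `E`, a map from output signals to families of functions of `(t,x)`, is causal:
its value at time `t` depends only on the values of the output signal on `[0,t]`. -/
def IsCausal {d : Fin S.N → ℕ} (E : S.Signal → ∀ i : Fin S.N, ℝ → ℝ → Fin (d i) → ℝ) : Prop :=
  ∀ (y y' : S.Signal) (t : ℝ), (∀ s ∈ Icc 0 t, y s = y' s) →
    ∀ i, ∀ x ∈ Icc (0 : ℝ) 1, E y i t x = E y' i t x

end HyperbolicChain

/-- The `τ`-delay operator `γ ↦ γ̄`, `γ̄(t) = γ(t - τ)`. -/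
def delayed {α : Type*} (τ : ℝ) (γ : ℝ → α) : ℝ → α := fun t => γ (t - τ)

end

/-!
The spatial averages of a solution over a short window that moves along a characteristic are
differentiable in time, because the transport term cancels the motion of the window. Letting the
window shrink, the state itself is differentiable along the characteristics, and its derivative is
the coupling term. Followed from any point to the right end `x = 1`, this is an integral equation
of Volterra type, so the state of a subsystem in a trapezoid is determined by its values at `x = 1`.

The output and the boundary condition give the state at the right end of the last subsystem. Once
the state of subsystem `i` at `x = 0` is known, `u_i = Q_{i,i} v_i + Q_{i,i-1} u_{i-1}` and the
injectivity of `Q_{i,i-1}` give `u_{i-1}`, and then `v_{i-1}`, at the right end of subsystem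
`i - 1`. So the information moves to the left through the chain, and two solutions with the same
output on `[0, t]` have the same state at time `t - τ`. Hence the estimator at time `t` may return
the delayed state of any trajectory that is consistent with the output on `[0, t]`.
-/

section UnitInterval

theorem enorm_setIntegral_le_eLpNorm {α E : Type*} [MeasurableSpace α] {μ : Measure α}
    [IsProbabilityMeasure μ] [NormedAddCommGroup E] [NormedSpace ℝ E] {p : ENNReal} (hp : 1 ≤ p)
    {d : α → E} (hd : AEStronglyMeasurable d μ) (s : Set α) :
    ‖∫ x in s, d x ∂μ‖ₑ ≤ eLpNorm d p μ :=
  calc ‖∫ x in s, d x ∂μ‖ₑ ≤ ∫⁻ x in s, ‖d x‖ₑ ∂μ := enorm_integral_le_lintegral_enorm d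
    _ ≤ ∫⁻ x, ‖d x‖ₑ ∂μ := setLIntegral_le_lintegral s _
    _ = eLpNorm d 1 μ := eLpNorm_one_eq_lintegral_enorm.symm
    _ ≤ eLpNorm d p μ := eLpNorm_le_eLpNorm_of_exponent_le hp hd

instance isProbabilityMeasure_restrict_unitInterval :
    IsProbabilityMeasure (volume.restrict (Icc (0 : ℝ) 1)) := ⟨by simp⟩

variable {d g : ℝ → ℝ} {a b : ℝ}

theorem uIoc_subset_unitInterval (ha : a ∈ Icc (0 : ℝ) 1) (hb : b ∈ Icc (0 : ℝ) 1) :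
    uIoc a b ⊆ Icc 0 1 :=
  uIoc_subset_uIcc.trans (uIcc_subset_Icc ha hb)

theorem enorm_intervalIntegral_le_eLpNorm_unitInterval {p : ENNReal} (hp : 1 ≤ p)
    (hd : AEStronglyMeasurable d (volume.restrict (Icc (0 : ℝ) 1)))
    (ha : a ∈ Icc (0 : ℝ) 1) (hb : b ∈ Icc (0 : ℝ) 1) :
    ‖∫ x in a..b, d x‖ₑ ≤ eLpNorm d p (volume.restrict (Icc (0 : ℝ) 1)) := by
  have h := enorm_setIntegral_le_eLpNorm hp hd (uIoc a b)
  rwa [Measure.restrict_restrict_of_subset (uIoc_subset_unitInterval ha hb),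
    enorm_eq_iff_norm_eq.2 (intervalIntegral.norm_intervalIntegral_eq d a b volume).symm] at h

theorem intervalIntegrable_of_memLp_unitInterval {p : ENNReal} (hp : 1 ≤ p)
    (hd : MemLp d p (volume.restrict (Icc (0 : ℝ) 1)))
    (ha : a ∈ Icc (0 : ℝ) 1) (hb : b ∈ Icc (0 : ℝ) 1) : IntervalIntegrable d volume a b :=
  have h : IntegrableOn d (Icc 0 1) := hd.integrable hp
  intervalIntegrable_iff.2 (h.mono_set (uIoc_subset_unitInterval ha hb))

theorem memLp_unitInterval_of_continuousOn (hd : ContinuousOn d (Icc 0 1)) (p : ENNReal) :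
    MemLp d p (volume.restrict (Icc (0 : ℝ) 1)) := by
  obtain ⟨C, hC⟩ := isCompact_Icc.exists_bound_of_continuousOn hd
  exact MemLp.of_bound (hd.aestronglyMeasurable measurableSet_Icc) C
    (ae_restrict_of_forall_mem measurableSet_Icc hC)

theorem intervalIntegrable_of_continuousOn_unitInterval (hd : ContinuousOn d (Icc 0 1))
    (ha : a ∈ Icc (0 : ℝ) 1) (hb : b ∈ Icc (0 : ℝ) 1) : IntervalIntegrable d volume a b :=
  (hd.mono (uIcc_subset_Icc ha hb)).intervalIntegrable

/-- `d ∈ H¹([0,1])` with weak derivative `g`. -/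
structure MemH1 (d g : ℝ → ℝ) : Prop where
  memLp_deriv : MemLp g 2 (volume.restrict (Icc (0 : ℝ) 1))
  eq_add_integral : ∀ x ∈ Icc (0 : ℝ) 1, d x = d 0 + ∫ ξ in (0 : ℝ)..x, g ξ

namespace MemH1

variable {d' g' : ℝ → ℝ}

theorem intervalIntegrable_deriv (h : MemH1 d g) (ha : a ∈ Icc (0 : ℝ) 1)
    (hb : b ∈ Icc (0 : ℝ) 1) : IntervalIntegrable g volume a b :=
  intervalIntegrable_of_memLp_unitInterval one_le_two h.memLp_deriv ha hb

theorem sub_eq_integral (h : MemH1 d g) (ha : a ∈ Icc (0 : ℝ) 1) (hb : b ∈ Icc (0 : ℝ) 1) :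
    d b - d a = ∫ ξ in a..b, g ξ := by
  have h0 : (0 : ℝ) ∈ Icc (0 : ℝ) 1 := left_mem_Icc.2 zero_le_one
  rw [h.eq_add_integral a ha, h.eq_add_integral b hb, add_sub_add_left_eq_sub]
  exact intervalIntegral.integral_interval_sub_left (h.intervalIntegrable_deriv h0 hb)
    (h.intervalIntegrable_deriv h0 ha)

theorem continuousOn (h : MemH1 d g) : ContinuousOn d (Icc 0 1) := by
  have hg : IntegrableOn g (uIcc 0 1) := by
    rw [uIcc_of_le zero_le_one]
    exact h.memLp_deriv.integrable one_le_two
  have hprim := intervalIntegral.continuousOn_primitive_interval hg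
  rw [uIcc_of_le zero_le_one] at hprim
  exact (continuousOn_const.add hprim).congr h.eq_add_integral

theorem sub (h : MemH1 d g) (h' : MemH1 d' g') : MemH1 (d - d') (g - g') where
  memLp_deriv := h.memLp_deriv.sub h'.memLp_deriv
  eq_add_integral x hx := by
    have h0 : (0 : ℝ) ∈ Icc (0 : ℝ) 1 := left_mem_Icc.2 zero_le_one
    simp only [Pi.sub_apply]
    rw [intervalIntegral.integral_sub (h.intervalIntegrable_deriv h0 hx)
      (h'.intervalIntegrable_deriv h0 hx), h.eq_add_integral x hx, h'.eq_add_integral x hx]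
    ring

theorem aestronglyMeasurable (h : MemH1 d g) :
    AEStronglyMeasurable d (volume.restrict (Icc (0 : ℝ) 1)) :=
  h.continuousOn.aestronglyMeasurable measurableSet_Icc

theorem enorm_le_eLpNorm_add_eLpNorm_deriv (h : MemH1 d g) {x : ℝ} (hx : x ∈ Icc (0 : ℝ) 1) :
    ‖d x‖ₑ ≤ eLpNorm d 2 (volume.restrict (Icc (0 : ℝ) 1))
      + eLpNorm g 2 (volume.restrict (Icc (0 : ℝ) 1)) := by
  set ν := volume.restrict (Icc (0 : ℝ) 1)
  have hpointwise : ∀ y ∈ Icc (0 : ℝ) 1, ‖d x‖ₑ ≤ ‖d y‖ₑ + eLpNorm g 2 ν := fun y hy =>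
    calc ‖d x‖ₑ = ‖d y + (d x - d y)‖ₑ := by rw [add_sub_cancel]
      _ ≤ ‖d y‖ₑ + ‖d x - d y‖ₑ := enorm_add_le _ _
      _ ≤ ‖d y‖ₑ + eLpNorm g 2 ν := by
        rw [h.sub_eq_integral hy hx]
        gcongr
        exact enorm_intervalIntegral_le_eLpNorm_unitInterval one_le_two
          h.memLp_deriv.aestronglyMeasurable hy hx
  calc ‖d x‖ₑ = ∫⁻ _, ‖d x‖ₑ ∂ν := by simp
    _ ≤ ∫⁻ y, (‖d y‖ₑ + eLpNorm g 2 ν) ∂ν := setLIntegral_mono' measurableSet_Icc hpointwise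
    _ = eLpNorm d 1 ν + eLpNorm g 2 ν := by
      rw [lintegral_add_right _ measurable_const, eLpNorm_one_eq_lintegral_enorm]
      simp
    _ ≤ eLpNorm d 2 ν + eLpNorm g 2 ν := by
      gcongr
      exact eLpNorm_le_eLpNorm_of_exponent_le one_le_two h.aestronglyMeasurable

end MemH1

end UnitInterval

namespace IsContinuousInH1

variable {f g : ℝ → ℝ → ℝ}

theorem memH1 (hf : IsContinuousInH1 f g) {t : ℝ} (ht : 0 ≤ t) : MemH1 (f t) (g t) :=
  ⟨hf.memLp t ht, hf.eq_integral t ht⟩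

theorem continuousOn_uncurry (hf : IsContinuousInH1 f g) :
    ContinuousOn (fun p : ℝ × ℝ => f p.1 p.2) (Ici 0 ×ˢ Icc 0 1) := by
  rintro ⟨t, x⟩ ⟨ht, hx⟩
  have htime : Tendsto (fun p : ℝ × ℝ => f p.1 p.2 - f t p.2)
      (𝓝[Ici 0 ×ˢ Icc (0 : ℝ) 1] (t, x)) (𝓝 0) := by
    have hfst : Tendsto Prod.fst (𝓝[Ici 0 ×ˢ Icc (0 : ℝ) 1] (t, x)) (𝓝[Ici 0] t) := by
      rw [nhdsWithin_prod_eq]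
      exact tendsto_fst
    have hnorms := ((hf.continuous t ht).add (hf.continuous_deriv t ht)).comp hfst
    rw [tendsto_zero_iff_enorm_tendsto_zero]
    refine tendsto_of_tendsto_of_tendsto_of_le_of_le' tendsto_const_nhds (by simpa using hnorms)
      (Eventually.of_forall fun _ => zero_le) ?_
    filter_upwards [self_mem_nhdsWithin] with p hp
    exact ((hf.memH1 hp.1).sub (hf.memH1 ht)).enorm_le_eLpNorm_add_eLpNorm_deriv hp.2
  have hspace : Tendsto (fun p : ℝ × ℝ => f t p.2)
      (𝓝[Ici 0 ×ˢ Icc (0 : ℝ) 1] (t, x)) (𝓝 (f t x)) := by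
    rw [nhdsWithin_prod_eq]
    exact ((hf.memH1 ht).continuousOn x hx).tendsto.comp tendsto_snd
  simpa [ContinuousWithinAt] using htime.add hspace

end IsContinuousInH1

section ShrinkingWindows

variable {ι E : Type*} [NormedAddCommGroup E] [NormedSpace ℝ E] [CompleteSpace E]
  {l : Filter ι} {A B : ι → ℝ} {G : ι → ℝ → E} {x₀ : ℝ} {L : E}

theorem isLittleO_integral_sub_smul_of_tendsto_prod
    (hA : Tendsto A l (𝓝 x₀)) (hB : Tendsto B l (𝓝 x₀))
    (hG : Tendsto (fun p : ι × ℝ => G p.1 p.2) (l ×ˢ 𝓝 x₀) (𝓝 L))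
    (hint : ∀ᶠ i in l, IntervalIntegrable (G i) volume (A i) (B i)) :
    (fun i => (∫ x in A i..B i, G i x) - (B i - A i) • L) =o[l] fun i => B i - A i := by
  refine Asymptotics.isLittleO_iff.2 fun δ hδ => ?_
  have hnear : ∀ᶠ p in l ×ˢ 𝓝 x₀, ‖G p.1 p.2 - L‖ < δ := by
    simpa only [dist_eq_norm] using Metric.tendsto_nhds.1 hG δ hδ
  obtain ⟨P, hP, Q, hQ, hPQ⟩ := eventually_prod_iff.1 hnear
  obtain ⟨r, hr, hball⟩ := Metric.eventually_nhds_iff_ball.1 hQ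
  filter_upwards [hP, hA (Metric.ball_mem_nhds x₀ hr), hB (Metric.ball_mem_nhds x₀ hr), hint]
    with i hi hAi hBi hGi
  rw [← intervalIntegral.integral_const, ← intervalIntegral.integral_sub hGi (by simp),
    Real.norm_eq_abs]
  refine intervalIntegral.norm_integral_le_of_norm_le_const fun x hx => ?_
  have hxball : x ∈ Metric.ball x₀ r :=
    (convex_ball x₀ r).ordConnected.uIcc_subset hAi hBi (uIoc_subset_uIcc hx)
  exact (hPQ hi (hball x hxball)).le

theorem tendsto_average_of_tendsto_prod
    (hA : Tendsto A l (𝓝 x₀)) (hB : Tendsto B l (𝓝 x₀)) (hAB : ∀ᶠ i in l, A i ≠ B i)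
    (hG : Tendsto (fun p : ι × ℝ => G p.1 p.2) (l ×ˢ 𝓝 x₀) (𝓝 L))
    (hint : ∀ᶠ i in l, IntervalIntegrable (G i) volume (A i) (B i)) :
    Tendsto (fun i => (B i - A i)⁻¹ • ∫ x in A i..B i, G i x) l (𝓝 L) := by
  have h := (isLittleO_integral_sub_smul_of_tendsto_prod hA hB hG hint).tendsto_inv_smul_nhds_zero
  refine tendsto_sub_nhds_zero_iff.1 (h.congr' ?_)
  filter_upwards [hAB] with i hi
  rw [smul_sub, inv_smul_smul₀ (sub_ne_zero.2 hi.symm)]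

theorem hasDerivAt_integral_of_tendsto_prod {G : ℝ → ℝ → E} {t B' : ℝ}
    {B : ℝ → ℝ} (hB : HasDerivAt B B' t)
    (hG : Tendsto (fun p : ℝ × ℝ => G p.1 p.2) (𝓝 t ×ˢ 𝓝 (B t)) (𝓝 L))
    (hint : ∀ᶠ s in 𝓝 t, IntervalIntegrable (G s) volume (B t) (B s)) :
    HasDerivAt (fun s => ∫ x in B t..B s, G s x) (B' • L) t := by
  have h := (isLittleO_integral_sub_smul_of_tendsto_prod tendsto_const_nhds hB.continuousAt hG
    hint).trans_isBigO hB.hasFDerivAt.isBigO_sub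
  have hlin := (hB.sub_const (B t)).smul_const L
  have hrest : HasDerivAt (fun s => (∫ x in B t..B s, G s x) - (B s - B t) • L) 0 t :=
    hasDerivAt_iff_isLittleO.2 <| by simpa using h
  simpa using hrest.fun_add hlin

end ShrinkingWindows

namespace HasTimeDerivInL2

variable {f h : ℝ → ℝ → ℝ} {t : ℝ}

theorem hasDerivAt_integral (hfh : HasTimeDerivInL2 f h) (ht : 0 < t)
    (hf : ∀ᶠ s in 𝓝 t, MemLp (f s) 2 (volume.restrict (Icc (0 : ℝ) 1)))
    (hh : MemLp (h t) 2 (volume.restrict (Icc (0 : ℝ) 1))) {a b : ℝ}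
    (ha : a ∈ Icc (0 : ℝ) 1) (hb : b ∈ Icc (0 : ℝ) 1) :
    HasDerivAt (fun s => ∫ x in a..b, f s x) (∫ x in a..b, h t x) t := by
  have hft := hf.self_of_nhds
  have hint {d : ℝ → ℝ} (hd : MemLp d 2 (volume.restrict (Icc (0 : ℝ) 1))) :
      IntervalIntegrable d volume a b :=
    intervalIntegrable_of_memLp_unitInterval one_le_two hd ha hb
  have hremainder : Tendsto (fun s => ∫ x in a..b, ((s - t)⁻¹ * (f s x - f t x) - h t x))
      (𝓝[≠] t) (𝓝 0) := by
    rw [tendsto_zero_iff_enorm_tendsto_zero]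
    refine tendsto_of_tendsto_of_tendsto_of_le_of_le' tendsto_const_nhds (hfh t ht)
      (Eventually.of_forall fun _ => zero_le) ?_
    filter_upwards [hf.filter_mono nhdsWithin_le_nhds] with s hs
    exact enorm_intervalIntegral_le_eLpNorm_unitInterval one_le_two
      (((hs.sub hft).const_mul _).sub hh).aestronglyMeasurable ha hb
  rw [hasDerivAt_iff_tendsto_slope, ← tendsto_sub_nhds_zero_iff]
  refine hremainder.congr' ?_
  filter_upwards [hf.filter_mono nhdsWithin_le_nhds] with s hs
  rw [intervalIntegral.integral_sub (((hint hs).sub (hint hft)).const_mul _) (hint hh),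
    intervalIntegral.integral_const_mul, intervalIntegral.integral_sub (hint hs) (hint hft),
    slope_def_field, div_eq_inv_mul]

theorem hasDerivAt_integral_moving (hfh : HasTimeDerivInL2 f h) (ht : 0 < t)
    (hf : ContinuousOn (fun p : ℝ × ℝ => f p.1 p.2) (Ici 0 ×ˢ Icc 0 1))
    (hh : MemLp (h t) 2 (volume.restrict (Icc (0 : ℝ) 1))) {A B : ℝ → ℝ} {A' B' : ℝ}
    (hA : HasDerivAt A A' t) (hB : HasDerivAt B B' t)
    (hAt : A t ∈ Ioo (0 : ℝ) 1) (hBt : B t ∈ Ioo (0 : ℝ) 1) :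
    HasDerivAt (fun s => ∫ x in A s..B s, f s x)
      ((∫ x in A t..B t, h t x) + (B' * f t (B t) - A' * f t (A t))) t := by
  have hAt' := Ioo_subset_Icc_self hAt
  have hBt' := Ioo_subset_Icc_self hBt
  have hpos : ∀ᶠ s in 𝓝 t, 0 ≤ s := (lt_mem_nhds ht).mono fun _ => le_of_lt
  have hsection : ∀ s, 0 ≤ s → ContinuousOn (f s) (Icc 0 1) := fun s hs =>
    hf.uncurry_left s hs
  have hmem {C : ℝ → ℝ} {C' : ℝ} (hC : HasDerivAt C C' t) (hCt : C t ∈ Ioo (0 : ℝ) 1) :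
      ∀ᶠ s in 𝓝 t, C s ∈ Icc (0 : ℝ) 1 :=
    hC.continuousAt.eventually_mem (Icc_mem_nhds hCt.1 hCt.2)
  have hend {C : ℝ → ℝ} {C' : ℝ} (hC : HasDerivAt C C' t) (hCt : C t ∈ Ioo (0 : ℝ) 1) :
      HasDerivAt (fun s => ∫ x in C t..C s, f s x) (C' * f t (C t)) t := by
    refine hasDerivAt_integral_of_tendsto_prod hC ?_ ?_
    · rw [← nhds_prod_eq]
      exact hf.continuousAt (prod_mem_nhds (Ici_mem_nhds ht) (Icc_mem_nhds hCt.1 hCt.2))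
    · filter_upwards [hpos, hmem hC hCt] with s hs hCs
      exact intervalIntegrable_of_continuousOn_unitInterval (hsection s hs)
        (Ioo_subset_Icc_self hCt) hCs
  have hfixed := hfh.hasDerivAt_integral ht
    (hpos.mono fun s hs => memLp_unitInterval_of_continuousOn (hsection s hs) 2) hh hAt' hBt'
  refine (hfixed.fun_add ((hend hB hBt).fun_sub (hend hA hAt))).congr_of_eventuallyEq ?_
  filter_upwards [hpos, hmem hA hAt, hmem hB hBt] with s hs hAs hBs
  have hint {y z : ℝ} := intervalIntegrable_of_continuousOn_unitInterval (hsection s hs)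
    (a := y) (b := z)
  rw [← intervalIntegral.integral_interval_sub_left (hint hAt' hBs) (hint hAt' hAs),
    ← intervalIntegral.integral_add_adjacent_intervals (hint hAt' hBt') (hint hBt' hBs),
    add_sub_assoc]

end HasTimeDerivInL2

theorem tendsto_average_moving_window {G : ℝ → ℝ → ℝ}
    (hG : ContinuousOn (fun p : ℝ × ℝ => G p.1 p.2) (Ici 0 ×ˢ Icc 0 1)) {a c t : ℝ} (ht : 0 < t)
    (ha : a + c * t ∈ Ioo (0 : ℝ) 1) :
    Tendsto (fun q : ℝ × ℝ => q.1⁻¹ * ∫ x in (a + c * q.2)..(a + q.1 + c * q.2), G q.2 x)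
      (𝓝[>] 0 ×ˢ 𝓝 t) (𝓝 (G t (a + c * t))) := by
  have hle : 𝓝[>] (0 : ℝ) ×ˢ 𝓝 t ≤ 𝓝 (0, t) := by
    rw [nhds_prod_eq]
    exact prod_mono_left _ nhdsWithin_le_nhds
  have hA : Tendsto (fun q : ℝ × ℝ => a + c * q.2) (𝓝[>] 0 ×ˢ 𝓝 t) (𝓝 (a + c * t)) :=
    (Continuous.tendsto' (by fun_prop) _ _ rfl).mono_left hle
  have hB : Tendsto (fun q : ℝ × ℝ => a + q.1 + c * q.2) (𝓝[>] 0 ×ˢ 𝓝 t) (𝓝 (a + c * t)) :=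
    (Continuous.tendsto' (by fun_prop) _ _ (by simp)).mono_left hle
  have hAB : ∀ᶠ q : ℝ × ℝ in 𝓝[>] 0 ×ˢ 𝓝 t, a + c * q.2 ≠ a + q.1 + c * q.2 := by
    filter_upwards [tendsto_fst.eventually self_mem_nhdsWithin] with q hq
    simpa using (ne_of_gt hq : q.1 ≠ 0)
  have hlim : Tendsto (fun p : (ℝ × ℝ) × ℝ => G p.1.2 p.2)
      ((𝓝[>] 0 ×ˢ 𝓝 t) ×ˢ 𝓝 (a + c * t)) (𝓝 (G t (a + c * t))) := by
    have hcont := hG.continuousAt (x := (t, a + c * t))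
      (prod_mem_nhds (Ici_mem_nhds ht) (Icc_mem_nhds ha.1 ha.2))
    rw [ContinuousAt, nhds_prod_eq] at hcont
    exact hcont.comp (tendsto_snd.prodMap tendsto_id)
  have hint : ∀ᶠ q : ℝ × ℝ in 𝓝[>] 0 ×ˢ 𝓝 t,
      IntervalIntegrable (G q.2) volume (a + c * q.2) (a + q.1 + c * q.2) := by
    filter_upwards [tendsto_snd.eventually (lt_mem_nhds ht), hA (Icc_mem_nhds ha.1 ha.2),
      hB (Icc_mem_nhds ha.1 ha.2)] with q hq hAq hBq
    exact intervalIntegrable_of_continuousOn_unitInterval (hG.uncurry_left q.2 hq.le) hAq hBq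
  refine (tendsto_average_of_tendsto_prod hA hB hAB hlim hint).congr fun q => ?_
  rw [smul_eq_mul]
  congr 2
  ring

section Characteristics

variable {t x σ ρ : ℝ}

theorem time_pos_along_characteristic (ht : 0 ≤ t) (htρ : 0 ≤ t + σ * ρ) (hσ : σ ≠ 0) {r : ℝ}
    (hr : r ∈ Ioo 0 ρ) : 0 < t + σ * r := by
  rcases hσ.lt_or_gt with hneg | hpos
  · exact htρ.trans_lt (add_lt_add_right (mul_lt_mul_of_neg_left hr.2 hneg) t)
  · exact add_pos_of_nonneg_of_pos ht (mul_pos hpos hr.1)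

theorem time_nonneg_along_characteristic (ht : 0 ≤ t) (htρ : 0 ≤ t + σ * ρ) {r : ℝ}
    (hr : r ∈ Icc 0 ρ) : 0 ≤ t + σ * r := by
  rcases le_total σ 0 with hneg | hpos
  · exact htρ.trans (add_le_add_right (mul_le_mul_of_nonpos_left hr.2 hneg) t)
  · exact add_nonneg ht (mul_nonneg hpos hr.1)

theorem continuousOn_along_characteristic {E : Type*} [TopologicalSpace E] {G : ℝ → ℝ → E}
    (hG : ContinuousOn (fun p : ℝ × ℝ => G p.1 p.2) (Ici 0 ×ˢ Icc 0 1))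
    (ht : 0 ≤ t) (hx : 0 ≤ x) (hxρ : x + ρ ≤ 1) (htρ : 0 ≤ t + σ * ρ) :
    ContinuousOn (fun r => G (t + σ * r) (x + r)) (Icc 0 ρ) := by
  refine hG.comp (f := fun r => (t + σ * r, x + r)) (by fun_prop) fun r hr => ?_
  exact ⟨time_nonneg_along_characteristic ht htρ hr, by linarith [hr.1], by linarith [hr.2]⟩

end Characteristics

namespace IsContinuousInH1

variable {f g F : ℝ → ℝ → ℝ} {c t x ρ : ℝ}

theorem hasDerivAt_integral_moving (hf : IsContinuousInH1 f g)
    (hF : ContinuousOn (fun p : ℝ × ℝ => F p.1 p.2) (Ici 0 ×ˢ Icc 0 1))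
    (hft : HasTimeDerivInL2 f fun t x => -c * g t x + F t x) (ht : 0 < t) {a b : ℝ}
    (ha : a + c * t ∈ Ioo (0 : ℝ) 1) (hb : b + c * t ∈ Ioo (0 : ℝ) 1) :
    HasDerivAt (fun s => ∫ x in (a + c * s)..(b + c * s), f s x)
      (∫ x in (a + c * t)..(b + c * t), F t x) t := by
  have ha' := Ioo_subset_Icc_self ha
  have hb' := Ioo_subset_Icc_self hb
  have hline (z : ℝ) : HasDerivAt (fun s => z + c * s) c t := by
    simpa using ((hasDerivAt_id t).const_mul c).const_add z
  have hH1 := hf.memH1 ht.le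
  have hFt := hF.uncurry_left t ht.le
  refine (hft.hasDerivAt_integral_moving ht hf.continuousOn_uncurry
    ((hH1.memLp_deriv.const_mul _).add (memLp_unitInterval_of_continuousOn hFt 2))
    (hline a) (hline b) ha hb).congr_deriv ?_
  rw [intervalIntegral.integral_add ((hH1.intervalIntegrable_deriv ha' hb').const_mul _)
    (intervalIntegrable_of_continuousOn_unitInterval hFt ha' hb'),
    intervalIntegral.integral_const_mul, ← hH1.sub_eq_integral ha' hb']
  ring

theorem hasDerivAt_along_characteristic (hf : IsContinuousInH1 f g)
    (hF : ContinuousOn (fun p : ℝ × ℝ => F p.1 p.2) (Ici 0 ×ˢ Icc 0 1))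
    (hft : HasTimeDerivInL2 f fun t x => -c * g t x + F t x) (ht : 0 < t) {a : ℝ}
    (ha : a + c * t ∈ Ioo (0 : ℝ) 1) :
    HasDerivAt (fun s => f s (a + c * s)) (F t (a + c * t)) t := by
  have hinterior : ∀ᶠ s in 𝓝 t, 0 < s ∧ a + c * s ∈ Ioo (0 : ℝ) 1 :=
    (lt_mem_nhds ht).and
      ((Continuous.continuousAt (by fun_prop)).eventually_mem (isOpen_Ioo.mem_nhds ha))
  -- Pointwise in space nothing is known about the time derivative, but averages over a window
  -- that moves along the characteristic are differentiable, with uniformly convergent derivatives.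
  have huniform : TendstoUniformlyOnFilter
      (fun ε s => ε⁻¹ * ∫ x in (a + c * s)..(a + ε + c * s), F s x)
      (fun s => F s (a + c * s)) (𝓝[>] 0) (𝓝 t) := by
    refine tendstoUniformlyOnFilter_iff_tendsto.2 (Tendsto.mono_right ?_
      (nhds_le_uniformity (F t (a + c * t))))
    refine Tendsto.prodMk_nhds ?_ (tendsto_average_moving_window hF ht ha)
    have hFcont := hF.continuousAt (x := (t, a + c * t))
      (prod_mem_nhds (Ici_mem_nhds ht) (Icc_mem_nhds ha.1 ha.2))
    have hcurve : ContinuousAt (fun s => (s, a + c * s)) t := by fun_prop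
    exact (hFcont.comp_of_eq hcurve rfl).tendsto.comp tendsto_snd
  refine hasDerivAt_of_tendstoUniformlyOnFilter
    (f := fun ε s => ε⁻¹ * ∫ x in (a + c * s)..(a + ε + c * s), f s x) huniform ?_ ?_
  · have hright : ∀ᶠ q : ℝ × ℝ in 𝓝[>] 0 ×ˢ 𝓝 t, a + q.1 + c * q.2 ∈ Ioo (0 : ℝ) 1 := by
      have hcont : ContinuousAt (fun q : ℝ × ℝ => a + q.1 + c * q.2) (0, t) := by fun_prop
      have hmem := hcont.eventually_mem (isOpen_Ioo.mem_nhds (by simpa using ha))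
      rw [nhds_prod_eq] at hmem
      exact hmem.filter_mono (prod_mono_left _ nhdsWithin_le_nhds)
    filter_upwards [tendsto_snd.eventually hinterior, hright] with q hq hq'
    exact (hf.hasDerivAt_integral_moving hF hft hq.1 hq.2 hq').const_mul _
  · filter_upwards [hinterior] with s hs
    exact (tendsto_average_moving_window hf.continuousOn_uncurry hs.1 hs.2).comp
      (tendsto_id.prodMk (tendsto_const_nhds (x := s)))

theorem sub_eq_integral_along_characteristic (hf : IsContinuousInH1 f g)
    (hF : ContinuousOn (fun p : ℝ × ℝ => F p.1 p.2) (Ici 0 ×ˢ Icc 0 1))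
    (hft : HasTimeDerivInL2 f fun t x => -c * g t x + F t x) (hc : c ≠ 0)
    (ht : 0 ≤ t) (hx : 0 ≤ x) (hρ : 0 ≤ ρ) (hxρ : x + ρ ≤ 1) (htρ : 0 ≤ t + c⁻¹ * ρ) :
    f (t + c⁻¹ * ρ) (x + ρ) - f t x = ∫ r in (0 : ℝ)..ρ, c⁻¹ * F (t + c⁻¹ * r) (x + r) := by
  have hposition (r : ℝ) : x - c * t + c * (t + c⁻¹ * r) = x + r := by
    field_simp
    ring
  have hderiv : ∀ r ∈ Ioo 0 ρ, HasDerivAt (fun r => f (t + c⁻¹ * r) (x + r))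
      (c⁻¹ * F (t + c⁻¹ * r) (x + r)) r := by
    intro r hr
    have hchar := hf.hasDerivAt_along_characteristic hF hft
      (time_pos_along_characteristic ht htρ (inv_ne_zero hc) hr) (a := x - c * t)
      (by rw [hposition]; exact ⟨by linarith [hr.1], by linarith [hr.2]⟩)
    have hclock : HasDerivAt (fun r => t + c⁻¹ * r) c⁻¹ r := by
      simpa using ((hasDerivAt_id r).const_mul c⁻¹).const_add t
    have hcomp := hchar.comp r hclock
    rw [hposition, mul_comm _ c⁻¹] at hcomp
    simpa only [Function.comp_def, hposition] using hcomp
  have hcont := continuousOn_along_characteristic hf.continuousOn_uncurry ht hx hxρ htρ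
  have hint := (continuousOn_along_characteristic hF ht hx hxρ htρ).intervalIntegrable_of_Icc
    (μ := volume) hρ
  simpa using (intervalIntegral.integral_eq_sub_of_hasDerivAt_of_le hρ hcont hderiv
    (hint.const_mul c⁻¹)).symm

end IsContinuousInH1

section MulVec

variable {X m n : Type*} [TopologicalSpace X] [Fintype n] {s : Set X}

theorem continuousOn_mulVec {R : Type*} [TopologicalSpace R] [NonUnitalNonAssocSemiring R]
    [ContinuousAdd R] [ContinuousMul R] {A : X → Matrix m n R} {y : X → n → R}
    (hA : ContinuousOn A s) (hy : ContinuousOn y s) : ContinuousOn (fun x => A x *ᵥ y x) s :=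
  continuousOn_iff_continuous_domRestrict.2 (hA.domRestrict.matrix_mulVec hy.domRestrict)

open scoped Matrix.Norms.Operator in
theorem exists_norm_mulVec_le_of_continuousOn {R : Type*} [NonUnitalSeminormedRing R] [Fintype m]
    {A : X → Matrix m n R} (hs : IsCompact s) (hA : ContinuousOn A s) :
    ∃ C, 0 ≤ C ∧ ∀ x ∈ s, ∀ y, ‖A x *ᵥ y‖ ≤ C * ‖y‖ := by
  obtain ⟨C, hC⟩ := hs.exists_bound_of_continuousOn hA
  refine ⟨max C 0, le_max_right C 0, fun x hx y => (Matrix.linfty_opNorm_mulVec (A x) y).trans ?_⟩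
  gcongr
  exact (hC x hx).trans (le_max_left C 0)

end MulVec

theorem integral_mul_exp_mul_sub (L y : ℝ) :
    ∫ r in 0..y, L * Real.exp (L * (y - r)) = Real.exp (L * y) - 1 := by
  rw [intervalIntegral.integral_const_mul,
    intervalIntegral.integral_comp_sub_left (fun r => Real.exp (L * r)) y, sub_self, sub_zero,
    intervalIntegral.mul_integral_comp_mul_left, mul_zero, integral_exp, Real.exp_zero]

/-- The domain of determination of `[a, b] × {1}` in the time-space strip `ℝ × [0, 1]`, when a wave
needs at most the time `α` to cross `[0, 1]` leftwards and at most the time `β` to cross it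
rightwards. -/
def trapezoid (a b α β : ℝ) : Set (ℝ × ℝ) :=
  {p | p.2 ∈ Icc 0 1 ∧ p.1 ∈ Icc (a + α * (1 - p.2)) (b - β * (1 - p.2))}

section Trapezoid

variable {a b α β : ℝ}

theorem isCompact_trapezoid (a b α β : ℝ) : IsCompact (trapezoid a b α β) := by
  have hclosed : IsClosed (trapezoid a b α β) := by
    simp only [trapezoid, mem_Icc, ofPred_and]
    refine .inter (.inter ?_ ?_) (.inter ?_ ?_) <;>
      exact isClosed_le (by fun_prop) (by fun_prop)
  have hbox : IsCompact (Icc (a - |α|) (b + |β|) ×ˢ Icc (0 : ℝ) 1) :=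
    isCompact_Icc.prod isCompact_Icc
  refine hbox.of_isClosed_subset hclosed ?_
  rintro ⟨t, x⟩ ⟨hx, hat, htb⟩
  have hbound (γ : ℝ) : |γ * (1 - x)| ≤ |γ| := by
    rw [abs_mul, abs_of_nonneg (sub_nonneg.2 hx.2)]
    exact mul_le_of_le_one_right (abs_nonneg γ) (by linarith [hx.1])
  exact ⟨⟨by linarith [neg_le_of_abs_le (hbound α)], by linarith [neg_le_of_abs_le (hbound β)]⟩, hx⟩

theorem trapezoid_subset_Ici_prod_Icc (ha : 0 ≤ a) (hα : 0 ≤ α) :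
    trapezoid a b α β ⊆ Ici 0 ×ˢ Icc 0 1 := fun _ hp =>
  ⟨(add_nonneg ha (mul_nonneg hα (sub_nonneg.2 hp.1.2))).trans hp.2.1, hp.1⟩

theorem add_mem_trapezoid {t x σ ρ : ℝ} (hp : (t, x) ∈ trapezoid a b α β) (hασ : -α ≤ σ)
    (hσβ : σ ≤ β) (hρ : 0 ≤ ρ) (hxρ : x + ρ ≤ 1) : (t + σ * ρ, x + ρ) ∈ trapezoid a b α β := by
  obtain ⟨hx, hat, htb⟩ := hp
  have hleft := mul_le_mul_of_nonneg_right hασ hρ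
  have hright := mul_le_mul_of_nonneg_right hσβ hρ
  exact ⟨⟨by linarith [hx.1], hxρ⟩, by linarith, by linarith⟩

end Trapezoid

section MildSolution

variable {ι : Type*} [Fintype ι]

/-- `w` is a continuous solution on `[0, ∞) × [0, 1]` of `∂ₜ w + diag(c) ∂ₓ w = A(x) w`, in the
sense that the equation holds in integrated form along the characteristics, which are followed
towards larger `x` and parametrized by space; the speeds `c k` are supposed not to vanish. -/
structure IsMildSolution (c : ι → ℝ) (A : ℝ → Matrix ι ι ℝ) (w : ℝ → ℝ → ι → ℝ) : Prop where
  continuousOn : ContinuousOn (fun p : ℝ × ℝ => w p.1 p.2) (Ici 0 ×ˢ Icc 0 1)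
  sub_eq_integral : ∀ k t x ρ, 0 ≤ t → 0 ≤ x → 0 ≤ ρ → x + ρ ≤ 1 → 0 ≤ t + (c k)⁻¹ * ρ →
    w (t + (c k)⁻¹ * ρ) (x + ρ) k - w t x k =
      ∫ r in (0 : ℝ)..ρ, (c k)⁻¹ * (A (x + r) *ᵥ w (t + (c k)⁻¹ * r) (x + r)) k

theorem continuousOn_mulVec_uncurry {A : ℝ → Matrix ι ι ℝ} {w : ℝ → ℝ → ι → ℝ}
    (hA : ContinuousOn A (Icc 0 1))
    (hw : ContinuousOn (fun p : ℝ × ℝ => w p.1 p.2) (Ici 0 ×ˢ Icc 0 1)) :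
    ContinuousOn (fun p : ℝ × ℝ => A p.2 *ᵥ w p.1 p.2) (Ici 0 ×ˢ Icc 0 1) :=
  continuousOn_mulVec (hA.comp continuousOn_snd fun _ hp => hp.2) hw

namespace IsMildSolution

variable {c : ι → ℝ} {A : ℝ → Matrix ι ι ℝ} {w w' : ℝ → ℝ → ι → ℝ}

theorem of_hasTimeDerivInL2 (hc : ∀ k, c k ≠ 0) (hA : ContinuousOn A (Icc 0 1))
    (h : ∀ k, ∃ g, IsContinuousInH1 (fun t x => w t x k) g ∧
      HasTimeDerivInL2 (fun t x => w t x k) fun t x => -c k * g t x + (A x *ᵥ w t x) k) :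
    IsMildSolution c A w := by
  have hw : ContinuousOn (fun p : ℝ × ℝ => w p.1 p.2) (Ici 0 ×ˢ Icc 0 1) :=
    continuousOn_pi.2 fun k => (h k).choose_spec.1.continuousOn_uncurry
  refine ⟨hw, fun k t x ρ ht hx hρ hxρ htρ => ?_⟩
  obtain ⟨g, hg, hgt⟩ := h k
  exact hg.sub_eq_integral_along_characteristic
    (continuousOn_pi.1 (continuousOn_mulVec_uncurry hA hw) k) hgt (hc k) ht hx hρ hxρ htρ

theorem sub (h : IsMildSolution c A w) (h' : IsMildSolution c A w')
    (hA : ContinuousOn A (Icc 0 1)) : IsMildSolution c A (w - w') where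
  continuousOn := h.continuousOn.sub h'.continuousOn
  sub_eq_integral k t x ρ ht hx hρ hxρ htρ := by
    simp only [Pi.sub_apply, Matrix.mulVec_sub, mul_sub]
    have hint {z : ℝ → ℝ → ι → ℝ} (hz : IsMildSolution c A z) : IntervalIntegrable
        (fun r => (A (x + r) *ᵥ z (t + (c k)⁻¹ * r) (x + r)) k) volume 0 ρ :=
      (continuousOn_pi.1 (continuousOn_along_characteristic (G := fun t x => A x *ᵥ z t x)
        (continuousOn_mulVec_uncurry hA hz.continuousOn) ht hx hxρ htρ) k).intervalIntegrable_of_Icc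
        hρ
    rw [intervalIntegral.integral_sub ((hint h).const_mul _) ((hint h').const_mul _),
      ← h.sub_eq_integral k t x ρ ht hx hρ hxρ htρ, ← h'.sub_eq_integral k t x ρ ht hx hρ hxρ htρ]
    ring

variable {a b α β L M : ℝ}

theorem norm_le_mul_exp_sub_one (h : IsMildSolution c A w) (ha : 0 ≤ a) (hα : 0 ≤ α)
    (hcα : ∀ k, -α ≤ (c k)⁻¹) (hcβ : ∀ k, (c k)⁻¹ ≤ β) (hL : 0 ≤ L)
    (hA : ∀ x ∈ Icc (0 : ℝ) 1, ∀ y k, |(c k)⁻¹ * (A x *ᵥ y) k| ≤ L * ‖y‖)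
    (hend : ∀ t ∈ Icc a b, w t 1 = 0)
    (hw : ∀ p ∈ trapezoid a b α β, ‖w p.1 p.2‖ ≤ M * Real.exp (L * (1 - p.2)))
    {t x : ℝ} (hp : (t, x) ∈ trapezoid a b α β) :
    ‖w t x‖ ≤ M * (Real.exp (L * (1 - x)) - 1) := by
  have hM : 0 ≤ M := nonneg_of_mul_nonneg_left ((norm_nonneg _).trans (hw _ hp)) (Real.exp_pos _)
  have hx : 0 ≤ 1 - x := sub_nonneg.2 hp.1.2
  have hexp : 1 ≤ Real.exp (L * (1 - x)) := Real.one_le_exp (mul_nonneg hL hx)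
  refine (pi_norm_le_iff_of_nonneg (mul_nonneg hM (sub_nonneg.2 hexp))).2 fun k => ?_
  have hchar : ∀ r ∈ Icc 0 (1 - x), (t + (c k)⁻¹ * r, x + r) ∈ trapezoid a b α β := fun r hr =>
    add_mem_trapezoid hp (hcα k) (hcβ k) hr.1 (by linarith [hr.2])
  have hfinal := hchar (1 - x) (right_mem_Icc.2 hx)
  rw [add_sub_cancel] at hfinal
  have hexit : w (t + (c k)⁻¹ * (1 - x)) 1 = 0 := hend _ (by simpa using hfinal.2)
  have hsource : ∀ r ∈ Icc 0 (1 - x),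
      ‖(c k)⁻¹ * (A (x + r) *ᵥ w (t + (c k)⁻¹ * r) (x + r)) k‖
        ≤ L * (M * Real.exp (L * (1 - x - r))) := by
    intro r hr
    have hmem := hchar r hr
    refine (hA _ hmem.1 _ k).trans (mul_le_mul_of_nonneg_left ?_ hL)
    simpa only [sub_sub] using hw _ hmem
  have hdomain := trapezoid_subset_Ici_prod_Icc (b := b) (β := β) ha hα
  have hmild := h.sub_eq_integral k t x (1 - x) (hdomain hp).1 (hdomain hp).2.1 hx
    (by linarith) (hdomain hfinal).1
  rw [add_sub_cancel, hexit, Pi.zero_apply, zero_sub] at hmild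
  have hbound_int : IntervalIntegrable (fun r => L * (M * Real.exp (L * (1 - x - r)))) volume
      0 (1 - x) := (by fun_prop : Continuous _).intervalIntegrable _ _
  calc ‖w t x k‖ = ‖∫ r in 0..(1 - x),
        (c k)⁻¹ * (A (x + r) *ᵥ w (t + (c k)⁻¹ * r) (x + r)) k‖ := by rw [← hmild, norm_neg]
    _ ≤ ∫ r in 0..(1 - x), L * (M * Real.exp (L * (1 - x - r))) :=
      intervalIntegral.norm_integral_le_of_norm_le hx
        (.of_forall fun r hr => hsource r (Ioc_subset_Icc_self hr)) hbound_int
    _ = M * (Real.exp (L * (1 - x)) - 1) := by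
      simp only [mul_left_comm L M, intervalIntegral.integral_const_mul M, integral_mul_exp_mul_sub]

theorem eq_zero_of_mem_trapezoid (h : IsMildSolution c A w) (hA : ContinuousOn A (Icc 0 1))
    (ha : 0 ≤ a) (hα : 0 ≤ α) (hcα : ∀ k, -α ≤ (c k)⁻¹) (hcβ : ∀ k, (c k)⁻¹ ≤ β)
    (hend : ∀ t ∈ Icc a b, w t 1 = 0) {t x : ℝ} (hp : (t, x) ∈ trapezoid a b α β) :
    w t x = 0 := by
  classical
  obtain ⟨L, hL, hbound⟩ := exists_norm_mulVec_le_of_continuousOn isCompact_Icc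
    ((continuous_const.matrix_mul continuous_id).comp_continuousOn hA : ContinuousOn
      (fun x => Matrix.diagonal (fun k => (c k)⁻¹) * A x) (Icc 0 1))
  have hsource : ∀ x ∈ Icc (0 : ℝ) 1, ∀ y k, |(c k)⁻¹ * (A x *ᵥ y) k| ≤ L * ‖y‖ := by
    intro x hx y k
    rw [← Matrix.mulVec_diagonal (fun k => (c k)⁻¹), Matrix.mulVec_mulVec]
    exact (norm_le_pi_norm _ k).trans (hbound x hx y)
  have hw := h.continuousOn.mono (trapezoid_subset_Ici_prod_Icc (b := b) (β := β) ha hα)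
  -- At a maximum point of the norm weighted by `exp (-L (1 - x))`, `norm_le_mul_exp_sub_one`
  -- bounds the maximum `M` by something smaller, unless `M = 0`.
  obtain ⟨q, hq, hmax⟩ := (isCompact_trapezoid a b α β).exists_isMaxOn ⟨_, hp⟩
    (hw.norm.mul (g := fun p => Real.exp (-(L * (1 - p.2)))) (by fun_prop))
  set M := ‖w q.1 q.2‖ * Real.exp (-(L * (1 - q.2))) with hM
  have hweight : ∀ p ∈ trapezoid a b α β, ‖w p.1 p.2‖ ≤ M * Real.exp (L * (1 - p.2)) := by
    intro p hp
    have hle : ‖w p.1 p.2‖ * Real.exp (-(L * (1 - p.2))) ≤ M := hmax hp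
    rwa [Real.exp_neg, ← div_eq_mul_inv, div_le_iff₀ (Real.exp_pos _)] at hle
  have hattained : ‖w q.1 q.2‖ = M * Real.exp (L * (1 - q.2)) := by
    rw [hM, mul_assoc, ← Real.exp_add, neg_add_cancel, Real.exp_zero, mul_one]
  have hcontract := h.norm_le_mul_exp_sub_one ha hα hcα hcβ hL hsource hend hweight hq
  have hM0 : M ≤ 0 := by linarith
  exact norm_le_zero_iff.1 ((hweight _ hp).trans
    (mul_nonpos_of_nonpos_of_nonneg hM0 (Real.exp_pos _).le))

theorem eq_of_mem_trapezoid (h : IsMildSolution c A w) (h' : IsMildSolution c A w')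
    (hA : ContinuousOn A (Icc 0 1)) (ha : 0 ≤ a) (hα : 0 ≤ α) (hcα : ∀ k, -α ≤ (c k)⁻¹)
    (hcβ : ∀ k, (c k)⁻¹ ≤ β) (hend : ∀ t ∈ Icc a b, w t 1 = w' t 1) {t x : ℝ}
    (hp : (t, x) ∈ trapezoid a b α β) : w t x = w' t x :=
  sub_eq_zero.1 <| (h.sub h' hA).eq_zero_of_mem_trapezoid hA ha hα hcα hcβ
    (fun t ht => sub_eq_zero.2 (hend t ht)) hp

end IsMildSolution

end MildSolution

theorem mulVec_injective_of_rank_eq_card {K m n : Type*} [Field K] [Fintype n]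
    {A : Matrix m n K} (hA : A.rank = Fintype.card n) : Function.Injective A.mulVec := by
  rw [Matrix.mulVec_injective_iff, linearIndependent_iff_card_eq_finrank_span, Set.finrank,
    ← Matrix.rank_eq_finrank_span_cols, hA]

theorem continuousOn_fromBlocks {X R l m n o : Type*} [TopologicalSpace X] [TopologicalSpace R]
    {s : Set X} {A : X → Matrix n l R} {B : X → Matrix n m R} {C : X → Matrix o l R}
    {D : X → Matrix o m R} (hA : ContinuousOn A s) (hB : ContinuousOn B s)
    (hC : ContinuousOn C s) (hD : ContinuousOn D s) :
    ContinuousOn (fun x => Matrix.fromBlocks (A x) (B x) (C x) (D x)) s :=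
  continuousOn_iff_continuous_domRestrict.2 (hA.domRestrict.matrix_fromBlocks hB.domRestrict
    hC.domRestrict hD.domRestrict)

/-- The time that a wave needs to travel from the position `x` of subsystem `i` to the right end of
the chain, or back, when it crosses subsystem `j` with speed `c j`. -/
noncomputable def travelTime {N : ℕ} (c : Fin N → ℝ) (i : Fin N) (x : ℝ) : ℝ :=
  1 / c i * (1 - x) + ∑ j ∈ Finset.Ioi i, 1 / c j

section TravelTime

variable {N : ℕ} {c : Fin N → ℝ} {i j : Fin N}

theorem travelTime_zero (c : Fin N → ℝ) (i : Fin N) :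
    travelTime c i 0 = ∑ j ∈ Finset.Ici i, 1 / c j := by
  rw [travelTime, sub_zero, mul_one, ← Finset.Ioi_insert, Finset.sum_insert (by simp)]

theorem travelTime_succ_zero (c : Fin N → ℝ) (hij : i.val = j.val + 1) :
    travelTime c i 0 = travelTime c j 1 := by
  have hsucc : Finset.Ici i = Finset.Ioi j := by
    ext l
    simp only [Finset.mem_Ici, Finset.mem_Ioi, Fin.le_def, Fin.lt_def]
    omega
  rw [travelTime_zero, hsucc, travelTime, sub_self, mul_zero, zero_add]

theorem travelTime_eq_add_one (c : Fin N → ℝ) (i : Fin N) (x : ℝ) :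
    travelTime c i x = travelTime c i 1 + 1 / c i * (1 - x) := by
  simp only [travelTime]
  ring

theorem travelTime_nonneg (hc : ∀ j, 0 < c j) (i : Fin N) {x : ℝ} (hx : x ≤ 1) :
    0 ≤ travelTime c i x :=
  add_nonneg (mul_nonneg (one_div_pos.2 (hc i)).le (sub_nonneg.2 hx))
    (Finset.sum_nonneg fun j _ => (one_div_pos.2 (hc j)).le)

theorem travelTime_le_sum_Ici (hc : ∀ j, 0 < c j) (i : Fin N) {x : ℝ} (hx : 0 ≤ x) :
    travelTime c i x ≤ ∑ j ∈ Finset.Ici i, 1 / c j := by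
  have hinv := (one_div_pos.2 (hc i)).le
  rw [← travelTime_zero, travelTime, travelTime]
  gcongr

theorem travelTime_le_sum (hc : ∀ j, 0 < c j) (i : Fin N) {x : ℝ} (hx : 0 ≤ x) :
    travelTime c i x ≤ ∑ j, 1 / c j :=
  (travelTime_le_sum_Ici hc i hx).trans <|
    Finset.sum_le_univ_sum_of_nonneg fun j => (one_div_pos.2 (hc j)).le

end TravelTime

namespace HyperbolicChain

variable {S : HyperbolicChain}

/-- The two families of states of subsystem `i` put together into one vector. -/
def state (u : S.RightState) (v : S.LeftState) (i : Fin S.N) (t x : ℝ) :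
    Fin (S.n i) ⊕ Fin (S.m i) → ℝ :=
  Sum.elim (u i t x) (v i t x)

variable (S) in
/-- The signed transport velocities of the components of `HyperbolicChain.state`. -/
def velocity (i : Fin S.N) : Fin (S.n i) ⊕ Fin (S.m i) → ℝ :=
  Sum.elim (S.lam i) (-S.mu i)

variable (S) in
/-- The in-domain couplings of subsystem `i`, acting on `HyperbolicChain.state`. -/
def coupling (i : Fin S.N) (x : ℝ) :
    Matrix (Fin (S.n i) ⊕ Fin (S.m i)) (Fin (S.n i) ⊕ Fin (S.m i)) ℝ :=
  Matrix.fromBlocks (S.Spp i x) (S.Spm i x) (S.Smp i x) (S.Smm i x)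

theorem eq_last_or_exists_succ (i : Fin S.N) : i = S.last ∨ ∃ j : Fin S.N, j.val = i.val + 1 := by
  by_cases hi : i.val + 1 < S.N
  · exact .inr ⟨⟨i.val + 1, hi⟩, rfl⟩
  · exact .inl (Fin.ext (by simp only [last]; omega))

theorem lamMin_pos (i : Fin S.N) : 0 < S.lamMin i := S.lam_pos i _

theorem muMin_pos (i : Fin S.N) : 0 < S.muMin i := S.mu_pos i _

theorem lamMin_le (i : Fin S.N) (k : Fin (S.n i)) : S.lamMin i ≤ S.lam i k :=
  (S.lam_strictMono i).monotone (Nat.zero_le k.val)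

theorem muMin_le (i : Fin S.N) (k : Fin (S.m i)) : S.muMin i ≤ S.mu i k :=
  (S.mu_strictMono i).monotone (Nat.zero_le k.val)

theorem velocity_ne_zero (i : Fin S.N) (k : Fin (S.n i) ⊕ Fin (S.m i)) : S.velocity i k ≠ 0 := by
  rcases k with k | k
  · exact (S.lam_pos i k).ne'
  · exact neg_ne_zero.2 (S.mu_pos i k).ne'

theorem inv_velocity_le (i : Fin S.N) (k : Fin (S.n i) ⊕ Fin (S.m i)) :
    (S.velocity i k)⁻¹ ≤ 1 / S.lamMin i := by
  rw [one_div]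
  rcases k with k | k
  · exact inv_anti₀ (lamMin_pos i) (lamMin_le i k)
  · exact (inv_nonpos.2 (neg_nonpos.2 (S.mu_pos i k).le)).trans (inv_pos.2 (lamMin_pos i)).le

theorem neg_le_inv_velocity (i : Fin S.N) (k : Fin (S.n i) ⊕ Fin (S.m i)) :
    -(1 / S.muMin i) ≤ (S.velocity i k)⁻¹ := by
  rw [one_div]
  rcases k with k | k
  · exact (neg_nonpos.2 (inv_pos.2 (muMin_pos i)).le).trans (inv_pos.2 (S.lam_pos i k)).le
  · simpa only [velocity, Sum.elim_inr, Pi.neg_apply, inv_neg, neg_le_neg_iff]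
      using inv_anti₀ (muMin_pos i) (muMin_le i k)

theorem continuousOn_coupling (i : Fin S.N) : ContinuousOn (S.coupling i) (Icc 0 1) :=
  continuousOn_fromBlocks (S.Spp_cont i) (S.Spm_cont i) (S.Smp_cont i) (S.Smm_cont i)

namespace IsSolution

variable {U U' : ℝ → Fin (S.n S.first) → ℝ} {u u' : S.RightState} {v v' : S.LeftState}

theorem isMildSolution (h : S.IsSolution U u v) (i : Fin S.N) :
    IsMildSolution (S.velocity i) (S.coupling i) (state u v i) := by
  refine .of_hasTimeDerivInL2 (velocity_ne_zero i) (continuousOn_coupling i) ?_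
  simp only [state, coupling, Matrix.fromBlocks_mulVec, Sum.elim_comp_inl, Sum.elim_comp_inr]
  rintro (k | k)
  · exact h.pde_u i k
  · simpa only [velocity, Sum.elim_inr, Pi.neg_apply, neg_neg] using h.pde_v i k

theorem state_eq_of_state_one_eq (h : S.IsSolution U u v) (h' : S.IsSolution U' u' v')
    {i : Fin S.N} {a b : ℝ} (ha : 0 ≤ a) (hend : ∀ t ∈ Icc a b, state u v i t 1 = state u' v' i t 1)
    {t x : ℝ} (hp : (t, x) ∈ trapezoid a b (1 / S.muMin i) (1 / S.lamMin i)) :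
    state u v i t x = state u' v' i t x :=
  (h.isMildSolution i).eq_of_mem_trapezoid (h'.isMildSolution i) (continuousOn_coupling i) ha
    (one_div_pos.2 (muMin_pos i)).le (neg_le_inv_velocity i) (inv_velocity_le i) hend hp

theorem state_last_one_eq (h : S.IsSolution U u v) (h' : S.IsSolution U' u' v') {t : ℝ}
    (ht : 0 ≤ t) (hy : S.output u t = S.output u' t) :
    state u v S.last t 1 = state u' v' S.last t 1 := by
  have hu : u S.last t 1 = u' S.last t 1 := hy
  rw [state, state, h.bc_v_last t ht, h'.bc_v_last t ht, hu]

theorem state_one_eq_of_succ_zero_eq (h : S.IsSolution U u v) (h' : S.IsSolution U' u' v')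
    {i j : Fin S.N} (hij : i.val = j.val + 1) (hQ : (S.Q i j).rank = S.n j) {t : ℝ} (ht : 0 ≤ t)
    (heq : state u v i t 0 = state u' v' i t 0) : state u v j t 1 = state u' v' j t 1 := by
  obtain ⟨hu, hv⟩ := Sum.elim_eq_iff.1 heq
  have hQu : S.Q i j *ᵥ u j t 1 = S.Q i j *ᵥ u' j t 1 := by
    rwa [h.bc_u i j hij t ht, h'.bc_u i j hij t ht, hv, add_right_inj] at hu
  have hinj : Function.Injective (S.Q i j).mulVec :=
    mulVec_injective_of_rank_eq_card (by rw [hQ, Fintype.card_fin])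
  rw [state, state, h.bc_v j i hij t ht, h'.bc_v j i hij t ht, hinj hQu, hv]

theorem state_eq_of_output_eq (hQ : ∀ i j : Fin S.N, i.val = j.val + 1 → (S.Q i j).rank = S.n j)
    (h : S.IsSolution U u v) (h' : S.IsSolution U' u' v') {T : ℝ}
    (hy : ∀ s ∈ Icc 0 T, S.output u s = S.output u' s) (i : Fin S.N) {t x : ℝ}
    (hx : x ∈ Icc (0 : ℝ) 1) (hmu : travelTime S.muMin i x ≤ t)
    (hlam : travelTime S.lamMin i x ≤ T - t) : state u v i t x = state u' v' i t x := by
  induction i using WellFoundedGT.induction generalizing t x with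
  | _ i ih =>
  have hmu0 := travelTime_nonneg (muMin_pos (S := S)) i le_rfl
  have hlam0 := travelTime_nonneg (lamMin_pos (S := S)) i le_rfl
  have hend : ∀ s ∈ Icc (travelTime S.muMin i 1) (T - travelTime S.lamMin i 1),
      state u v i s 1 = state u' v' i s 1 := by
    intro s hs
    have hs0 : 0 ≤ s := hmu0.trans hs.1
    rcases eq_last_or_exists_succ i with rfl | ⟨j, hj⟩
    · exact h.state_last_one_eq h' hs0 (hy s ⟨hs0, by linarith [hs.2]⟩)
    · refine h.state_one_eq_of_succ_zero_eq h' hj (hQ j i hj) hs0 (ih j (by omega) (by simp) ?_ ?_)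
      · exact (travelTime_succ_zero _ hj).trans_le hs.1
      · exact (travelTime_succ_zero _ hj).trans_le (le_sub_comm.1 hs.2)
  rw [travelTime_eq_add_one] at hmu hlam
  exact h.state_eq_of_state_one_eq h' hmu0 hend ⟨hx, hmu, by linarith⟩

end IsSolution

/-- The trajectories of the system, for any control input, that are consistent with the output
signal `y` up to time `t`. -/
def ConsistentTrajectory (S : HyperbolicChain) (y : S.Signal) (t : ℝ)
    (p : S.RightState × S.LeftState) : Prop :=
  (∃ U, S.IsSolution U p.1 p.2) ∧ ∀ s ∈ Icc 0 t, y s = S.output p.1 s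

theorem consistentTrajectory_congr {y y' : S.Signal} {t : ℝ} (h : ∀ s ∈ Icc 0 t, y s = y' s) :
    S.ConsistentTrajectory y t = S.ConsistentTrajectory y' t := by
  ext p
  exact and_congr_right fun _ => forall₂_congr fun s hs => by rw [h s hs]

/-- A choice of a trajectory consistent with the output signal `y` up to time `t`, arbitrary if
there is none. The estimators read the delayed state off this trajectory. -/
noncomputable def consistentTrajectory (S : HyperbolicChain) (y : S.Signal) (t : ℝ) :
    S.RightState × S.LeftState :=
  Classical.epsilon (S.ConsistentTrajectory y t)

theorem IsSolution.consistentTrajectory_spec {U : ℝ → Fin (S.n S.first) → ℝ} {u : S.RightState}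
    {v : S.LeftState} (h : S.IsSolution U u v) (t : ℝ) :
    S.ConsistentTrajectory (S.output u) t (S.consistentTrajectory (S.output u) t) :=
  Classical.epsilon_spec ⟨(u, v), ⟨U, h⟩, fun _ _ => rfl⟩

theorem isCausal_consistentTrajectory (S : HyperbolicChain) (τ : ℝ) :
    S.IsCausal (fun y i t x => (S.consistentTrajectory y t).1 i (t - τ) x) ∧
    S.IsCausal (fun y i t x => (S.consistentTrajectory y t).2 i (t - τ) x) := by
  constructor <;> intro y y' t h i x _ <;>
    simp only [consistentTrajectory, consistentTrajectory_congr h]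

end HyperbolicChain

theorem mainTheorem7_general (S : HyperbolicChain)
    (hQ : ∀ i j : Fin S.N, i.val = j.val + 1 → (S.Q i j).rank = S.n j) (τ : ℝ) :
    ∃ (uhat : S.Signal → S.RightState) (vhat : S.Signal → S.LeftState),
      S.IsCausal uhat ∧ S.IsCausal vhat ∧
      ∀ (U : ℝ → Fin (S.n S.first) → ℝ) (u : S.RightState) (v : S.LeftState),
        S.IsSolution U u v →
        ∀ (i : Fin S.N) (t : ℝ), ∀ x ∈ Icc (0 : ℝ) 1,
          travelTime S.lamMin i x ≤ τ → τ + travelTime S.muMin i x ≤ t →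
            uhat (S.output u) i t x = delayed τ (u i) t x ∧
            vhat (S.output u) i t x = delayed τ (v i) t x := by
  obtain ⟨hu, hv⟩ := S.isCausal_consistentTrajectory τ
  refine ⟨_, _, hu, hv, fun U u v h i t x hx hlam hmu => ?_⟩
  obtain ⟨⟨U', h'⟩, hy⟩ := h.consistentTrajectory_spec t
  exact Sum.elim_eq_iff.1 (h'.state_eq_of_output_eq hQ h (fun s hs => (hy s hs).symm) i hx
    (le_sub_iff_add_le'.2 hmu) (by rwa [sub_sub_cancel]))

theorem mainTheorem7 (S : HyperbolicChain)
    (hQ : ∀ i j : Fin S.N, i.val = j.val + 1 → (S.Q i j).rank = S.n j)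
    (τ : ℝ) (hτ : ∑ j, 1 / S.lamMin j < τ) :
    ∃ (uhat : S.Signal → S.RightState) (vhat : S.Signal → S.LeftState),
      S.IsCausal uhat ∧ S.IsCausal vhat ∧
      ∀ (U : ℝ → Fin (S.n S.first) → ℝ) (u : S.RightState) (v : S.LeftState),
        S.IsSolution U u v →
        ∀ (i : Fin S.N) (t : ℝ), τ + ∑ j ∈ Finset.Ici i, 1 / S.muMin j ≤ t →
          ∀ x ∈ Icc (0 : ℝ) 1,
            uhat (S.output u) i t x = delayed τ (u i) t x ∧
            vhat (S.output u) i t x = delayed τ (v i) t x := by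
  obtain ⟨uhat, vhat, hu, hv, hest⟩ := mainTheorem7_general S hQ τ
  refine ⟨uhat, vhat, hu, hv, fun U u v h i t ht x hx => hest U u v h i t x hx ?_ ?_⟩
  · exact (travelTime_le_sum HyperbolicChain.lamMin_pos i hx.1).trans hτ.le
  · exact (add_le_add_right (travelTime_le_sum_Ici HyperbolicChain.muMin_pos i hx.1) τ).trans ht
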